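/- Let $\Omega_{\text{cts}}(\mathbb{R})$ be the set of probability distributions on $\mathbb{R}$ that have a density with respect to Lebesgue measure. Let $t$ be a positive integer and $\beta\in\mathbb{R}$, with $\beta>0$ if $t$ is even, and let $$\Omega_0=\{P\in\Omega_{\text{cts}}(\mathbb{R}) : \mathbb{E}_P[|X|^t]<\infty,\ \mathbb{E}_P[X^t]=\beta\}.$$ Then: (1) $\Omega_0$ is locally-dense: there is a function $L:\mathbb{N}\to(0,\infty)$ such that for every $m$, all intervals $I_1,\dots,I_m\subset\mathbb{R}$ of length $|I_j|<L(m)$, and every probability density $p$ supported on $\bigcup_{j=1}^m I_j$, there exist a distribution $H\in\Omega_0$ with density $h$ and a number $\alpha\in(0,1]$ with $h(x)=\alpha p(x)$ for all $x\in\bigcup_{j=1}^m I_j$. (2) For every sample size $n$, $\Omega_0$ does not satisfy the randomization hypothesis: there is no group $\mathbb{G}$ (under composition) of measurable bijections $g:\mathbb{R}^n\to\mathbb{R}^n$ such that $\Omega_0\subseteq\Omega_{\mathbb{G}}\subsetneq\Omega_{\text{cts}}(\mathbb{R})$, where $\Omega_{\mathbb{G}}$ is the set of those $P\in\Omega_{\text{cts}}(\mathbb{R})$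 for which $gX$ and $X$ have the same distribution for every $g\in\mathbb{G}$ when $X=(X_1,\dots,X_n)$ has i.i.d. coordinates with distribution $P$. In particular (taking $t=1$, $\beta=0$) both conclusions hold for the null of continuous distributions with mean zero. -/

import Mathlib

open MeasureTheory

noncomputable section

namespace RandTest

/-- The set of continuous distributions on `ℝ`: the probability measures that have a density,
i.e. are absolutely continuous with respect to Lebesgue measure. -/
def OmegaCts : Set (ProbabilityMeasure ℝ) :=
  {P | (P : Measure ℝ) ≪ volume}

/-- The moment null: continuous distributions whose `t`-th moment exists (as a finite number)
and equals `β`. -/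
def momentNull (t : ℕ) (β : ℝ) : Set (ProbabilityMeasure ℝ) :=
  {P | P ∈ OmegaCts ∧ Integrable (fun x : ℝ => x ^ t) (P : Measure ℝ) ∧
    ∫ x : ℝ, x ^ t ∂(P : Measure ℝ) = β}

/-- `p` is (a version of) the Lebesgue density of the probability measure `P`. -/
def HasDensity (P : ProbabilityMeasure ℝ) (p : ℝ → ℝ) : Prop :=
  Measurable p ∧ (∀ x, 0 ≤ p x) ∧
    (P : Measure ℝ) = (volume : Measure ℝ).withDensity (fun x => ENNReal.ofReal (p x))

/-- A set of continuous distributions is locally-dense if there is `L : ℕ → (0, ∞)` such that for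
all (open, closed or half-open, possibly overlapping) intervals `I₁, …, I_m` of length less than
`L m` and every probability density `p` supported on their union, some distribution in the set has
a density `h` with `h = α p` on the union, for some `α ∈ (0, 1]`. -/
def LocallyDense (Ω₀ : Set (ProbabilityMeasure ℝ)) : Prop :=
  Ω₀ ⊆ OmegaCts ∧
  ∃ L : ℕ → ℝ, (∀ m, 0 < L m) ∧
    ∀ (m : ℕ) (I : Fin m → Set ℝ),
      (∀ j, (I j).OrdConnected) →
      (∀ j, volume (I j) < ENNReal.ofReal (L m)) →
      ∀ (Q : ProbabilityMeasure ℝ) (p : ℝ → ℝ), HasDensity Q p →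
        Function.support p ⊆ ⋃ j, I j →
        ∃ H ∈ Ω₀, ∃ h : ℝ → ℝ, HasDensity H h ∧
          ∃ α : ℝ, 0 < α ∧ α ≤ 1 ∧ ∀ x ∈ ⋃ j, I j, h x = α * p x

/-- The law of `X = (X₁, …, X_n)` with `X_i` i.i.d. from `P`. -/
def iidLaw (n : ℕ) (P : ProbabilityMeasure ℝ) : Measure (Fin n → ℝ) :=
  Measure.pi fun _ => (P : Measure ℝ)

/-- The distributions `P ∈ Ω` such that `g X` and `X` have the same law for every `g ∈ G`,
where `X` is an i.i.d. sample of size `n` from `P`. -/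
def invariantSet (n : ℕ) (Ω : Set (ProbabilityMeasure ℝ))
    (G : Subgroup (Equiv.Perm (Fin n → ℝ))) : Set (ProbabilityMeasure ℝ) :=
  {P | P ∈ Ω ∧ ∀ g ∈ G, (iidLaw n P).map g = iidLaw n P}

/-- The randomization hypothesis for the null `Ω₀` in the model `Ω`, with i.i.d. samples of size
`n`: there is a group `G` (under composition) of measurable transformations of the sample space
`ℝⁿ` such that `Ω₀` is contained in the set of `G`-invariant distributions, and the latter is a
proper subset of `Ω`. -/
def RandomizationHypothesis (n : ℕ) (Ω Ω₀ : Set (ProbabilityMeasure ℝ)) : Prop :=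
  ∃ G : Subgroup (Equiv.Perm (Fin n → ℝ)),
    (∀ g ∈ G, Measurable g) ∧ Ω₀ ⊆ invariantSet n Ω G ∧ invariantSet n Ω G ⊂ Ω

end RandTest

end

/-! ### Local density rules out the randomization hypothesis. -/

namespace RandTest

/-! Non-randomization: fix `g` in the group and cut `ℝⁿ` into boxes with short sides. The event that
`X` lies in one box and `gX` in another involves only `2n` short intervals, with union `U`. Local
density, applied to `P` conditioned on `U`, gives a null member `H` proportional to `P` on `U`. On
`Uⁿ` the sample laws are then proportional too, so the invariance of `H` passes to `P`. Countably
many pairs of boxes exhaust the space, so every continuous `P` is invariant and the inclusion cannot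
be proper (`LocallyDense.map_iidLaw_eq`).

Local density of the moment null: mix the given density with bounded ones placed off the intervals,
near points where `x ^ t` is below and above `β`. Suitable weights make the mean exactly `β`
(`locallyDense_integral_eq`). -/

/-- Finite product measures of proportional measures are proportional. -/
lemma pi_const_smul {n : ℕ} (c : ENNReal) (hc : c ≠ ⊤) (μ : Measure ℝ) [IsFiniteMeasure μ] :
    (Measure.pi fun _ : Fin n => c • μ) = c ^ n • Measure.pi fun _ : Fin n => μ := by
  have : IsFiniteMeasure (c • μ) := Measure.smul_finite μ hc
  refine (Measure.pi_eq fun s _ => ?_)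
  simp [Finset.prod_mul_distrib]

/-- The factor does not depend on `E`, so it cancels when an event in `Uⁿ` is compared with its
preimage, also in `Uⁿ`. -/
lemma pi_apply_of_restrict_eq_smul {n : ℕ} {μ ν : Measure ℝ} [IsFiniteMeasure μ]
    [IsFiniteMeasure ν] {c : ENNReal} (hc : c ≠ ⊤) {U : Set ℝ}
    (h : ν.restrict U = c • μ.restrict U) {E : Set (Fin n → ℝ)}
    (hEU : E ⊆ Set.univ.pi fun _ => U) :
    (Measure.pi fun _ : Fin n => ν) E = c ^ n * (Measure.pi fun _ : Fin n => μ) E := by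
  have key : ((Measure.pi fun _ : Fin n => ν).restrict (Set.univ.pi fun _ => U)) E =
      (c ^ n • (Measure.pi fun _ : Fin n => μ).restrict (Set.univ.pi fun _ => U)) E := by
    rw [Measure.restrict_pi_pi, Measure.restrict_pi_pi, h, pi_const_smul c hc]
  rwa [Measure.smul_apply, Measure.restrict_eq_self _ hEU, Measure.restrict_eq_self _ hEU,
    smul_eq_mul] at key

/-- Every member of a continuous model with positive mass on a finite union of short intervals is
proportional, on that union, to a member of a locally dense null. -/
lemma exists_restrict_eq_smul {Ω₀ : Set (ProbabilityMeasure ℝ)} {L : ℝ} {m : ℕ} {I : Fin m → Set ℝ}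
    (hI : ∀ j, (I j).OrdConnected) (hIL : ∀ j, volume (I j) < ENNReal.ofReal L)
    (hΩ : ∀ (I : Fin m → Set ℝ), (∀ j, (I j).OrdConnected) →
      (∀ j, volume (I j) < ENNReal.ofReal L) →
      ∀ (Q : ProbabilityMeasure ℝ) (p : ℝ → ℝ), HasDensity Q p →
        Function.support p ⊆ ⋃ j, I j →
        ∃ H ∈ Ω₀, ∃ h : ℝ → ℝ, HasDensity H h ∧
          ∃ α : ℝ, 0 < α ∧ α ≤ 1 ∧ ∀ x ∈ ⋃ j, I j, h x = α * p x)
    {P : ProbabilityMeasure ℝ} (hP : P ∈ OmegaCts) (hPU : (P : Measure ℝ) (⋃ j, I j) ≠ 0) :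
    ∃ H ∈ Ω₀, ∃ c : ENNReal, c ≠ 0 ∧ c ≠ ⊤ ∧
      (H : Measure ℝ).restrict (⋃ j, I j) = c • (P : Measure ℝ).restrict (⋃ j, I j) := by
  set U := ⋃ j, I j with hU
  set μ : Measure ℝ := (P : Measure ℝ) with hμ
  have hUm : MeasurableSet U := MeasurableSet.iUnion fun j => (hI j).measurableSet
  have hPtop : μ U ≠ ⊤ := measure_ne_top _ _
  set d : ENNReal := (μ U)⁻¹ with hd
  have hd0 : d ≠ 0 := ENNReal.inv_ne_zero.2 hPtop
  have hdt : d ≠ ⊤ := ENNReal.inv_ne_top.2 hPU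
  have hdens : volume.withDensity (μ.rnDeriv volume) = μ := Measure.withDensity_rnDeriv_eq _ _ hP
  -- Density of `P` conditioned on `U`; `toReal` loses nothing almost everywhere.
  let p : ℝ → ℝ := U.indicator fun x => (d * μ.rnDeriv volume x).toReal
  have hpm : Measurable p :=
    ((measurable_const.mul (Measure.measurable_rnDeriv _ _)).ennreal_toReal).indicator hUm
  have hae : (fun x => ENNReal.ofReal (p x)) =ᵐ[volume]
      U.indicator (d • μ.rnDeriv volume) := by
    filter_upwards [Measure.rnDeriv_lt_top μ volume] with x hx
    by_cases hxU : x ∈ U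
    · simp [p, hxU, ENNReal.ofReal_toReal, hdt, hx.ne]
    · simp [p, hxU]
  have hQ : volume.withDensity (fun x => ENNReal.ofReal (p x)) = d • μ.restrict U := by
    rw [withDensity_congr_ae hae, withDensity_indicator hUm,
      withDensity_smul _ (Measure.measurable_rnDeriv _ _), ← restrict_withDensity hUm, hdens]
  have hQp : IsProbabilityMeasure (d • μ.restrict U) :=
    ⟨by simp [hd, ENNReal.inv_mul_cancel hPU hPtop]⟩
  have hp0 : ∀ x, 0 ≤ p x := fun x => Set.indicator_nonneg (fun _ _ => ENNReal.toReal_nonneg) x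
  obtain ⟨H, hH, h, ⟨-, -, hHh⟩, α, hα, -, hhα⟩ := hΩ I hI hIL ⟨_, hQp⟩ p ⟨hpm, hp0, hQ.symm⟩
    (Set.support_indicator_subset)
  refine ⟨H, hH, ENNReal.ofReal α * d, mul_ne_zero (by simpa using hα) hd0,
    ENNReal.mul_ne_top ENNReal.ofReal_ne_top hdt, ?_⟩
  have : (H : Measure ℝ).restrict U =
      (ENNReal.ofReal α • volume.withDensity (fun x => ENNReal.ofReal (p x))).restrict U := by
    rw [hHh, ← withDensity_smul _ hpm.ennreal_ofReal, restrict_withDensity hUm,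
      restrict_withDensity hUm]
    refine withDensity_congr_ae ((ae_restrict_iff' hUm).2 (.of_forall fun x hx => ?_))
    simp [hhα x hx, ENNReal.ofReal_mul hα.le]
  rw [this, hQ, Measure.restrict_smul, Measure.restrict_smul, Measure.restrict_restrict hUm,
    Set.inter_self, smul_smul]

/-- Laws of samples from continuous distributions inherit the invariances of a locally dense
null. -/
lemma LocallyDense.map_iidLaw_eq {Ω₀ : Set (ProbabilityMeasure ℝ)} (hΩ : LocallyDense Ω₀) {n : ℕ}
    (hn : n ≠ 0) {g : Equiv.Perm (Fin n → ℝ)} (hg : Measurable g)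
    (hg' : Measurable g.symm)
    (hinv : ∀ H ∈ Ω₀, (iidLaw n H).map g = iidLaw n H)
    {P : ProbabilityMeasure ℝ} (hP : P ∈ OmegaCts) :
    (iidLaw n P).map g = iidLaw n P := by
  obtain ⟨-, L, hL, hΩ⟩ := hΩ
  -- Two boxes have `n + n` sides in total; halving makes their length strictly less than the bound.
  have hδ : 0 < L (n + n) / 2 := half_pos (hL _)
  set δ := L (n + n) / 2 with hδdef
  let J : ℤ → Set ℝ := fun k => Set.Ico (k • δ) ((k + 1) • δ)
  let box : (Fin n → ℤ) → Set (Fin n → ℝ) := fun k => Set.univ.pi fun i => J (k i)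
  have hJm : ∀ k, MeasurableSet (J k) := fun k => measurableSet_Ico
  have hbox : ∀ x : Fin n → ℝ, ∃ k, x ∈ box k := by
    intro x
    choose k hk _ using fun i => existsUnique_zsmul_near_of_pos hδ (x i)
    exact ⟨k, fun i _ => hk i⟩
  let s : (Fin n → ℤ) × (Fin n → ℤ) → Set (Fin n → ℝ) := fun kl => g.symm ⁻¹' box kl.1 ∩ box kl.2
  have hs : ⋃ kl, s kl = Set.univ := by
    refine Set.eq_univ_of_forall fun y => ?_
    obtain ⟨k, hk⟩ := hbox (g.symm y)
    obtain ⟨l, hl⟩ := hbox y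
    exact Set.mem_iUnion.2 ⟨(k, l), hk, hl⟩
  refine (Measure.ext_iff_of_iUnion_eq_univ hs).2 fun ⟨k, l⟩ => Measure.ext fun F hF => ?_
  rw [Measure.restrict_apply hF, Measure.restrict_apply hF]
  let I : Fin (n + n) → Set ℝ := Fin.append (fun i => J (k i)) (fun i => J (l i))
  have hI : ∀ j, ∃ r, I j = J r := fun j =>
    Fin.addCases (motive := fun j => ∃ r, I j = J r) (fun i => ⟨k i, Fin.append_left _ _ i⟩)
      (fun i => ⟨l i, Fin.append_right _ _ i⟩) j
  have hIc : ∀ j, (I j).OrdConnected := fun j => by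
    obtain ⟨r, hr⟩ := hI j
    rw [hr]; exact Set.ordConnected_Ico
  have hIL : ∀ j, volume (I j) < ENNReal.ofReal (L (n + n)) := fun j => by
    obtain ⟨r, hr⟩ := hI j
    rw [hr, Real.volume_Ico, ENNReal.ofReal_lt_ofReal_iff (hL _), add_smul, one_smul]
    linarith [hL (n + n)]
  have hkU : box k ⊆ Set.univ.pi fun _ => ⋃ j, I j :=
    Set.pi_mono fun i _ x hx => Set.mem_iUnion.2 ⟨Fin.castAdd n i, by simpa [I] using hx⟩
  have hlU : box l ⊆ Set.univ.pi fun _ => ⋃ j, I j :=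
    Set.pi_mono fun i _ x hx => Set.mem_iUnion.2 ⟨Fin.natAdd n i, by
      simpa only [I, Fin.append_right] using hx⟩
  have hFl : F ∩ s (k, l) ⊆ Set.univ.pi fun _ => ⋃ j, I j := fun x hx => hlU hx.2.2
  have hFk : g ⁻¹' (F ∩ s (k, l)) ⊆ Set.univ.pi fun _ => ⋃ j, I j := fun x hx =>
    hkU (by simpa using hx.2.1)
  have hE : MeasurableSet (F ∩ s (k, l)) :=
    hF.inter ((hg' (MeasurableSet.univ_pi fun i => hJm (k i))).inter
      (MeasurableSet.univ_pi fun i => hJm (l i)))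
  set U := ⋃ j, I j
  rw [Measure.map_apply hg hE]
  -- If `U` is null there is nothing to condition on, but then `Uⁿ` is null since `n ≠ 0`, and both
  -- sides vanish.
  by_cases hPU : (P : Measure ℝ) U = 0
  · have h0 : iidLaw n P (Set.univ.pi fun _ => U) = 0 := by
      simp [iidLaw, Measure.pi_pi, hPU, hn]
    rw [measure_mono_null hFk h0, measure_mono_null hFl h0]
  · obtain ⟨H, hH, c, hc0, hct, hc⟩ := exists_restrict_eq_smul hIc hIL (hΩ _) hP hPU
    have key := congrArg (fun ν => ν (F ∩ s (k, l))) (hinv H hH)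
    simp only [Measure.map_apply hg hE] at key
    unfold iidLaw at key ⊢
    rw [pi_apply_of_restrict_eq_smul hct hc hFk, pi_apply_of_restrict_eq_smul hct hc hFl] at key
    exact (ENNReal.mul_right_inj (pow_ne_zero n hc0) (ENNReal.pow_ne_top hct)).1 key

lemma LocallyDense.not_randomizationHypothesis {Ω₀ : Set (ProbabilityMeasure ℝ)}
    (hΩ : LocallyDense Ω₀) (n : ℕ) : ¬ RandomizationHypothesis n OmegaCts Ω₀ := by
  rintro ⟨G, hG, hsub, hss⟩
  refine hss.2 fun P hP => ⟨hP, fun g hg => ?_⟩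
  -- For `n = 0` the sample space is a single point and every `g` is the identity.
  rcases eq_or_ne n 0 with rfl | hn
  · have : (g : (Fin 0 → ℝ) → Fin 0 → ℝ) = id := funext fun x => Subsingleton.elim _ _
    rw [this, Measure.map_id]
  · exact hΩ.map_iidLaw_eq hn (hG g hg) (hG g⁻¹ (G.inv_mem hg)) (fun H hH => (hsub hH).2 g hg) hP

/-! ### Densities, mixtures and local density of moment nulls. -/

/-- A set of reals of positive finite volume supports a uniform distribution, which has a
density. -/
lemma exists_uniform_hasDensity {A : Set ℝ} (hA : MeasurableSet A) (h0 : volume A ≠ 0)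
    (ht : volume A ≠ ⊤) :
    ∃ (P : ProbabilityMeasure ℝ) (p : ℝ → ℝ), HasDensity P p ∧ Function.support p ⊆ A := by
  have hP : IsProbabilityMeasure ((volume A)⁻¹ • (volume : Measure ℝ).restrict A) :=
    ⟨by simp [ENNReal.inv_mul_cancel h0 ht]⟩
  refine ⟨⟨_, hP⟩, A.indicator fun _ => (volume A)⁻¹.toReal, ⟨measurable_const.indicator hA,
    fun x => Set.indicator_nonneg (fun _ _ => ENNReal.toReal_nonneg) x, ?_⟩,
    Set.support_indicator_subset⟩
  have : (fun x => ENNReal.ofReal (A.indicator (fun _ => (volume A)⁻¹.toReal) x)) =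
      A.indicator fun _ => (volume A)⁻¹ := by
    ext x
    by_cases hx : x ∈ A
    · rw [Set.indicator_of_mem hx, Set.indicator_of_mem hx,
        ENNReal.ofReal_toReal (ENNReal.inv_ne_top.2 h0)]
    · simp [hx]
  rw [this, withDensity_indicator hA, withDensity_const]
  rfl

lemma HasDensity.ae_mem {P : ProbabilityMeasure ℝ} {p : ℝ → ℝ} (h : HasDensity P p) {A : Set ℝ}
    (hA : Function.support p ⊆ A) : ∀ᵐ x ∂(P : Measure ℝ), x ∈ A := by
  rw [h.2.2, ae_withDensity_iff h.1.ennreal_ofReal]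
  refine .of_forall fun x hx => hA fun h0 => hx (by simp [h0])

lemma HasDensity.mem_omegaCts {P : ProbabilityMeasure ℝ} {p : ℝ → ℝ} (h : HasDensity P p) :
    P ∈ OmegaCts := by
  change (P : Measure ℝ) ≪ volume
  rw [h.2.2]
  exact withDensity_absolutelyContinuous _ _

/-- A continuous function is integrable for distributions with bounded support. -/
lemma integrable_of_ae_mem_isBounded {μ : Measure ℝ} [IsFiniteMeasure μ] {f : ℝ → ℝ}
    (hf : Continuous f) {A : Set ℝ} (hA : Bornology.IsBounded A) (h : ∀ᵐ x ∂μ, x ∈ A) :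
    Integrable f μ := by
  obtain ⟨C, hC⟩ := hA.isCompact_closure.exists_bound_of_continuousOn hf.continuousOn
  exact Integrable.of_bound hf.aestronglyMeasurable C (h.mono fun x hx => hC x (subset_closure hx))

lemma isBounded_of_ordConnected {I : Set ℝ} (hI : I.OrdConnected) (h : volume I ≠ ⊤) :
    Bornology.IsBounded I := by
  refine Metric.isBounded_iff.2 ⟨(volume I).toReal, fun x hx y hy => ?_⟩
  have h1 := ENNReal.toReal_mono h (measure_mono (μ := volume) (hI.uIcc_subset hx hy))
  rwa [Real.volume_interval, ENNReal.toReal_ofReal (abs_nonneg _), ← Real.dist_eq, dist_comm] at h1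

/-- The mixture of two distributions with densities. -/
lemma HasDensity.exists_mix {P Q : ProbabilityMeasure ℝ} {p q : ℝ → ℝ} (hP : HasDensity P p)
    (hQ : HasDensity Q q) {α : ℝ} (h0 : 0 ≤ α) (h1 : α ≤ 1) :
    ∃ H : ProbabilityMeasure ℝ, HasDensity H (fun x => α * p x + (1 - α) * q x) ∧
      ∀ f : ℝ → ℝ, Integrable f (P : Measure ℝ) → Integrable f (Q : Measure ℝ) →
        Integrable f (H : Measure ℝ) ∧ ∫ x, f x ∂(H : Measure ℝ) =
          α * ∫ x, f x ∂(P : Measure ℝ) + (1 - α) * ∫ x, f x ∂(Q : Measure ℝ) := by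
  have h1' : 0 ≤ 1 - α := sub_nonneg.2 h1
  have hH : IsProbabilityMeasure (ENNReal.ofReal α • (P : Measure ℝ) +
      ENNReal.ofReal (1 - α) • (Q : Measure ℝ)) := ⟨by
    simp [← ENNReal.ofReal_add h0 h1']⟩
  refine ⟨⟨_, hH⟩, ⟨(hP.1.const_mul _).add (hQ.1.const_mul _), fun x =>
    add_nonneg (mul_nonneg h0 (hP.2.1 x)) (mul_nonneg h1' (hQ.2.1 x)), ?_⟩, fun f hfP hfQ => ?_⟩
  · have : (fun x => ENNReal.ofReal (α * p x + (1 - α) * q x)) =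
        (ENNReal.ofReal α • fun x => ENNReal.ofReal (p x)) +
          ENNReal.ofReal (1 - α) • fun x => ENNReal.ofReal (q x) := by
      ext x
      simp [ENNReal.ofReal_add (mul_nonneg h0 (hP.2.1 x)) (mul_nonneg h1' (hQ.2.1 x)),
        ENNReal.ofReal_mul h0, ENNReal.ofReal_mul h1']
    rw [this, withDensity_add_left (hP.1.ennreal_ofReal.const_smul _),
      withDensity_smul _ hP.1.ennreal_ofReal, withDensity_smul _ hQ.1.ennreal_ofReal,
      ← hP.2.2, ← hQ.2.2]
    rfl
  · have i1 := hfP.smul_measure (c := ENNReal.ofReal α) ENNReal.ofReal_ne_top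
    have i2 := hfQ.smul_measure (c := ENNReal.ofReal (1 - α)) ENNReal.ofReal_ne_top
    refine ⟨i1.add_measure i2, ?_⟩
    simp only [ProbabilityMeasure.coe_mk]
    rw [integral_add_measure i1 i2, integral_smul_measure, integral_smul_measure,
      ENNReal.toReal_ofReal h0, ENNReal.toReal_ofReal h1', smul_eq_mul, smul_eq_mul]

/-- Strict pointwise bounds pass to expectations. -/
lemma integral_lt_of_ae_lt {P : ProbabilityMeasure ℝ} {f g : ℝ → ℝ}
    (hf : Integrable f (P : Measure ℝ)) (hg : Integrable g (P : Measure ℝ))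
    (h : ∀ᵐ x ∂(P : Measure ℝ), f x < g x) :
    ∫ x, f x ∂(P : Measure ℝ) < ∫ x, g x ∂(P : Measure ℝ) := by
  refine lt_of_le_of_ne (integral_mono_ae hf hg (h.mono fun _ => le_of_lt)) fun he => ?_
  have h2 := (integral_eq_iff_of_ae_le hf hg (h.mono fun _ => le_of_lt)).1 he
  obtain ⟨x, hx, hx'⟩ := (h.and h2).exists
  exact hx.ne hx'

/-- Weights of a mixture of three distributions that attains a prescribed mean. -/
lemma exists_mixture_weights {a b β : ℝ} (ha : a < β) (hb : β < b) (μ : ℝ) :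
    ∃ α s : ℝ, 0 < α ∧ α ≤ 1 ∧ 0 ≤ s ∧ s ≤ 1 ∧
      α * μ + (1 - α) * (s * a + (1 - s) * b) = β := by
  -- Take `γ` to be the endpoint across `β` from `μ`; with `d` its distance to `β`, the weight is `α
  -- = d / (d + |β - μ|)`.
  obtain ⟨γ, α, hα, hα1, haγ, hγb, hγ⟩ : ∃ γ α : ℝ, 0 < α ∧ α ≤ 1 ∧ a ≤ γ ∧ γ ≤ b ∧
      α * μ + (1 - α) * γ = β := by
    have hd : ∀ d : ℝ, 0 < d → 0 < d / (d + |β - μ|) ∧ d / (d + |β - μ|) ≤ 1 := fun d hd =>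
      ⟨by positivity, (div_le_one (by positivity)).2 (by linarith [abs_nonneg (β - μ)])⟩
    rcases le_total μ β with h | h
    · refine ⟨b, (b - β) / ((b - β) + |β - μ|), (hd _ (by linarith)).1, (hd _ (by linarith)).2,
        by linarith, le_rfl, ?_⟩
      rw [abs_of_nonneg (by linarith)]
      have : b - β + (β - μ) ≠ 0 := by linarith
      field_simp
      ring
    · refine ⟨a, (β - a) / ((β - a) + |β - μ|), (hd _ (by linarith)).1, (hd _ (by linarith)).2,
        le_rfl, by linarith, ?_⟩
      rw [abs_of_nonpos (by linarith)]
      have : β - a + -(β - μ) ≠ 0 := by linarith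
      field_simp
      ring
  have hab : 0 < b - a := by linarith
  refine ⟨α, (b - γ) / (b - a), hα, hα1, by apply div_nonneg <;> linarith,
    (div_le_one hab).2 (by linarith), ?_⟩
  rw [← hγ]
  congr 2
  field_simp
  ring

/-- Removing a set of small volume from a neighbourhood leaves room for a distribution. -/
lemma exists_hasDensity_support_subset_ball_diff {x r : ℝ} {U : Set ℝ} (hU : MeasurableSet U)
    (h : volume U < volume (Metric.ball x r)) :
    ∃ (P : ProbabilityMeasure ℝ) (p : ℝ → ℝ), HasDensity P p ∧
      Function.support p ⊆ Metric.ball x r \ U :=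
  exists_uniform_hasDensity (Metric.isOpen_ball.measurableSet.diff hU)
    (fun h0 => h.not_ge <| tsub_eq_zero_iff_le.1 <|
      nonpos_iff_eq_zero.1 (le_measure_sdiff.trans h0.le))
    ((measure_mono Set.sdiff_subset).trans_lt measure_ball_lt_top).ne

/-- The null fixing the expectation of a continuous function is locally dense if the function takes
values below and above the prescribed expectation. -/
lemma locallyDense_integral_eq {f : ℝ → ℝ} (hf : Continuous f) {β : ℝ} {x₀ x₁ : ℝ}
    (h₀ : f x₀ < β) (h₁ : β < f x₁) :
    LocallyDense {P | P ∈ OmegaCts ∧ Integrable f (P : Measure ℝ) ∧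
      ∫ x, f x ∂(P : Measure ℝ) = β} := by
  refine ⟨fun P hP => hP.1, ?_⟩
  obtain ⟨r₀, hr₀, hA⟩ := Metric.isOpen_iff.1 (isOpen_lt hf continuous_const) x₀ h₀
  obtain ⟨r₁, hr₁, hB⟩ := Metric.isOpen_iff.1 (isOpen_lt continuous_const hf) x₁ h₁
  set c := min r₀ r₁ with hc
  have hc0 : 0 < c := lt_min hr₀ hr₁
  -- The intervals cover less than `2 * c`, the length of a ball of radius `c`, so room remains near
  -- both points; `m + 1` keeps the bound positive at `m = 0`.
  refine ⟨fun m => c / (m + 1), fun m => by positivity, fun m I hI hIL Q p hQ hp => ?_⟩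
  set U := ⋃ j, I j with hUdef
  have hUm : MeasurableSet U := MeasurableSet.iUnion fun j => (hI j).measurableSet
  have hUv : volume U < ENNReal.ofReal (2 * c) := by
    calc volume U ≤ ∑ j, volume (I j) := measure_iUnion_fintype_le _ _
      _ ≤ ∑ _j : Fin m, ENNReal.ofReal (c / (m + 1)) :=
        Finset.sum_le_sum fun j _ => (hIL j).le
      _ = ENNReal.ofReal (m * (c / (m + 1))) := by
        rw [ENNReal.ofReal_mul (by positivity)]; simp
      _ < ENNReal.ofReal (2 * c) := by
        rw [ENNReal.ofReal_lt_ofReal_iff (by positivity), mul_div_assoc', div_lt_iff₀ (by positivity)]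
        nlinarith [(Nat.cast_nonneg m : (0 : ℝ) ≤ m)]
  have hball : ∀ x r, c ≤ r → volume U < volume (Metric.ball x r) := fun x r h => by
    rw [Real.volume_ball]
    exact hUv.trans_le (ENNReal.ofReal_le_ofReal (by linarith))
  have hUb : Bornology.IsBounded U :=
    Bornology.isBounded_iUnion.2 fun j => isBounded_of_ordConnected (hI j) (hIL j).ne_top
  obtain ⟨A, a, hAa, haA⟩ :=
    exists_hasDensity_support_subset_ball_diff hUm (hball x₀ r₀ (min_le_left _ _))
  obtain ⟨B, b, hBb, hbB⟩ :=
    exists_hasDensity_support_subset_ball_diff hUm (hball x₁ r₁ (min_le_right _ _))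
  have iQ : Integrable f (Q : Measure ℝ) := integrable_of_ae_mem_isBounded hf hUb (hQ.ae_mem hp)
  have iA : Integrable f (A : Measure ℝ) := integrable_of_ae_mem_isBounded hf
    Metric.isBounded_ball (hAa.ae_mem (haA.trans Set.sdiff_subset))
  have iB : Integrable f (B : Measure ℝ) := integrable_of_ae_mem_isBounded hf
    Metric.isBounded_ball (hBb.ae_mem (hbB.trans Set.sdiff_subset))
  have lA : ∫ x, f x ∂(A : Measure ℝ) < β := by
    simpa using integral_lt_of_ae_lt iA (integrable_const β)
      ((hAa.ae_mem haA).mono fun x hx => hA hx.1)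
  have lB : β < ∫ x, f x ∂(B : Measure ℝ) := by
    simpa using integral_lt_of_ae_lt (integrable_const β) iB
      ((hBb.ae_mem hbB).mono fun x hx => hB hx.1)
  obtain ⟨α, s, hα, hα1, hs, hs1, hsum⟩ :=
    exists_mixture_weights lA lB (∫ x, f x ∂(Q : Measure ℝ))
  obtain ⟨R, hR, hRf⟩ := hAa.exists_mix hBb hs hs1
  obtain ⟨iR, eR⟩ := hRf f iA iB
  obtain ⟨H, hH, hHf⟩ := hQ.exists_mix hR hα.le hα1
  obtain ⟨iH, eH⟩ := hHf f iQ iR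
  refine ⟨H, ⟨hH.mem_omegaCts, iH, by rw [eH, eR, hsum]⟩, _, hH, α, hα, hα1, fun x hx => ?_⟩
  -- The added densities vanish on `U`, so the mixture is `α * p` there.
  have ha0 : a x = 0 := by_contra fun h => (haA h).2 hx
  have hb0 : b x = 0 := by_contra fun h => (hbB h).2 hx
  simp [ha0, hb0]

/-- Since `|β| + 1 ≥ 1`, its `t`-th power exceeds `β`. A value below `β` is taken at `0` for even
`t`, where `β > 0` is needed, and at `-(|β| + 1)` for odd `t`. -/
lemma momentNull_locallyDense {t : ℕ} (ht : 0 < t) {β : ℝ} (hβ : Even t → 0 < β) :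
    LocallyDense (momentNull t β) := by
  have hup : β < (|β| + 1) ^ t := by
    have h := le_self_pow₀ (a := |β| + 1) (by linarith [abs_nonneg β]) ht.ne'
    linarith [le_abs_self β]
  rcases t.even_or_odd with h | h
  · exact locallyDense_integral_eq (continuous_pow t) (x₀ := 0)
      (by simpa [ht.ne'] using hβ h) hup
  · refine locallyDense_integral_eq (continuous_pow t) (x₀ := -(|β| + 1)) ?_ hup
    have h' := le_self_pow₀ (a := |β| + 1) (by linarith [abs_nonneg β]) ht.ne'
    rw [h.neg_pow]
    linarith [neg_abs_le β]

end RandTest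

theorem proposition7 (t : ℕ) (ht : 0 < t) (β : ℝ) (hβ : Even t → 0 < β) :
    RandTest.LocallyDense (RandTest.momentNull t β) ∧
      ∀ n : ℕ, ¬ RandTest.RandomizationHypothesis n RandTest.OmegaCts
        (RandTest.momentNull t β) :=
  have h := RandTest.momentNull_locallyDense ht hβ
  ⟨h, h.not_randomizationHypothesis⟩
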